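/- **Model.** Finitely many DAG tasks $\tau_i$ share finitely many resources $\ell_q$. Task $\tau_i$ has a finite directed acyclic graph with a unique head and a unique tail, a worst-case execution time $c(v)\ge 0$ for each vertex $v$, a period $T_i$ (consecutive releases are at least $T_i$ apart) and a relative deadline $0<D_i\le T_i$. Put $\mathcal C_i=\sum_v c(v)$ and let $\mathcal L_i$ be the largest total WCET of a path from head to tail. One job of $\tau_i$ accesses $\ell_q$ at most $N_{i,q}$ times, each time for at most $L_{i,q}$ time units (this time is part of the WCET); $\Theta_i=\{\ell_q: N_{i,q}>0\}$. All tasks have density $\mathcal C_i/D_i>1$. Of $m$ processors, pairwise disjoint sets are assigned to the tasks; each task runs on its own processors only, under a work-conserving scheduler. Resources are protected by non-nested spin locks: a vertex that requests a lock held by another vertex spins until it obtains the lock; spinning and lock holding are non-preemptive; waiting requests are served in an arbitrary order (unordered). A job has response time $f(J)-r(J)$ ($r$ release, $f$ finish, $f=\infty$ if it never finishes), $R_i$ is the supremum over the jobs of $\tau_i$, and $\tau_i$ is schedulable if $R_i\le D_i$. Let $$\eta_{i,j}^q=\begin{cases}\lceil (D_i+D_j)/T_j\rceil & \text{if } \ell_q\in\Theta_i\cap\Theta_j,\\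 0&\text{otherwise,}\end{cases}$$ $$S_i = D_i-\Big(\sum_{j\ne i}\sum_{\ell_q\in\Theta_i}\eta_{i,j}^q N_{j,q}L_{j,q}+\mathcal L_i+\sum_{\ell_q\in\Theta_i}N_{i,q}L_{i,q}\Big),\qquad m_i=\left\lceil\frac{\mathcal C_i-\big(\mathcal L_i+\sum_{\ell_q\in\Theta_i}N_{i,q}L_{i,q}\big)}{S_i}\right\rceil .$$ **Statement.** 1. If $S_i>0$ and $\tau_i$ is assigned exactly $m_i$ processors, then $\tau_i$ is schedulable in every run of the system in which each other task $\tau_j$ either is schedulable, or also has $S_j>0$ and is assigned exactly $m_j$ processors. 2. Consider the algorithm that goes through the tasks in any order and, for each $\tau_i$, returns "unschedulable" if $S_i\le 0$ or if fewer than $m_i$ processors are still available, and otherwise assigns $m_i$ processors to $\tau_i$; at the end it returns "schedulable". It returns "schedulable" if and only if $S_i>0$ for all $i$ and $\sum_i m_i\le m$, and the numbers of processors assigned are then the $m_i$. 3. If the algorithm returns "schedulable", then pairwise disjoint sets of processors with the assigned cardinalities exist, and for every such choice every task is schedulable in every run of the system. -/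

import Mathlib

open MeasureTheory

universe u v w

noncomputable section

/-- A DAG task with its timing parameters and its resource-access parameters. -/
structure DAGTask (Θ : Type v) where
  /-- The vertices of the DAG. -/
  V : Type u
  [finV : Fintype V]
  /-- `edge a b`: `a` is a predecessor of `b`. -/
  edge : V → V → Prop
  acyclic : ∀ a, ¬ Relation.TransGen edge a a
  /-- The unique vertex without predecessors. -/
  head : V
  /-- The unique vertex without successors. -/
  tail : V
  head_iff : ∀ a, (∀ b, ¬ edge b a) ↔ a = head
  tail_iff : ∀ a, (∀ b, ¬ edge a b) ↔ a = tail
  /-- Worst-case execution time of a vertex (lock-holding time included, spinning excluded). -/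
  wcet : V → ℝ
  wcet_nonneg : ∀ a, 0 ≤ wcet a
  /-- Period (minimal distance of two consecutive releases). -/
  T : ℝ
  /-- Relative deadline. -/
  D : ℝ
  D_pos : 0 < D
  D_le_T : D ≤ T
  /-- Worst-case number of accesses to each resource by one job. -/
  N : Θ → ℕ
  /-- Worst-case duration of a single access to each resource. -/
  L : Θ → ℝ
  L_nonneg : ∀ q, 0 ≤ L q

attribute [instance] DAGTask.finV

namespace DAGTask

variable {Θ : Type v}

/-- Total worst-case execution time `C`. -/
def totalWork (τ : DAGTask.{u, v} Θ) : ℝ := ∑ a, τ.wcet a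

/-- Complete paths: from the head to the tail along edges. -/
def IsCompletePath (τ : DAGTask.{u, v} Θ) (π : List τ.V) : Prop :=
  π.IsChain τ.edge ∧ π.head? = some τ.head ∧ π.getLast? = some τ.tail

/-- Length of a path. -/
def len (τ : DAGTask.{u, v} Θ) (π : List τ.V) : ℝ := (π.map τ.wcet).sum

/-- The longest length among the complete paths. There are finitely many of them and at least
one, so this supremum is a maximum. -/
def longest (τ : DAGTask.{u, v} Θ) : ℝ := sSup {x | ∃ π, τ.IsCompletePath π ∧ x = τ.len π}

/-- Density `C / D`. -/
def density (τ : DAGTask.{u, v} Θ) : ℝ := τ.totalWork / τ.D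

/-- The task accesses the resource `q`. -/
def Accesses (τ : DAGTask.{u, v} Θ) (q : Θ) : Prop := 0 < τ.N q

open Classical in
/-- The set of resources accessed by the task. -/
def resources [Fintype Θ] (τ : DAGTask.{u, v} Θ) : Finset Θ := {q | τ.Accesses q}

end DAGTask

section Analysis

variable {ι : Type w} {Θ : Type v}

open Classical in
/-- `η i j q`: the bound on the number of jobs of task `j` contending for `q` with a job
of task `i`. -/
def eta (τ : ι → DAGTask.{u, v} Θ) (i j : ι) (q : Θ) : ℕ :=
  if (τ i).Accesses q ∧ (τ j).Accesses q then ⌈((τ i).D + (τ j).D) / (τ j).T⌉₊ else 0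

variable [Fintype Θ]

/-- The intra-task term `∑ N_{i,q} L_{i,q}` over the resources accessed by task `i`. -/
def intraTerm (τ : ι → DAGTask.{u, v} Θ) (i : ι) : ℝ :=
  ∑ q ∈ (τ i).resources, ((τ i).N q : ℝ) * (τ i).L q

variable [Fintype ι] [DecidableEq ι]

/-- The inter-task blocking term of task `i`. -/
def interTerm (τ : ι → DAGTask.{u, v} Θ) (i : ι) : ℝ :=
  ∑ j ∈ Finset.univ.erase i, ∑ q ∈ (τ i).resources,
    (eta τ i j q : ℝ) * ((τ j).N q : ℝ) * (τ j).L q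

/-- The slack `D_i - (inter-task term + longest path + intra-task term)`. -/
def slack (τ : ι → DAGTask.{u, v} Θ) (i : ι) : ℝ :=
  (τ i).D - (interTerm τ i + (τ i).longest + intraTerm τ i)

/-- The number of processors `m_i`. -/
def procCount (τ : ι → DAGTask.{u, v} Θ) (i : ι) : ℕ :=
  ⌈((τ i).totalWork - ((τ i).longest + intraTerm τ i)) / slack τ i⌉₊

open Classical in
/-- The processor partitioning algorithm for unordered locks: the arguments are the tasks still to
be treated, the number of processors still available, and the numbers of processors assigned so
far. The answer `none` is "unschedulable"; `some A` is "schedulable", with the numbers of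
processors `A`. -/
def partitionAlg (τ : ι → DAGTask.{u, v} Θ) : List ι → ℕ → (ι → ℕ) → Option (ι → ℕ)
  | [], _, A => some A
  | i :: ts, avail, A =>
      if 0 < slack τ i then
        if avail < procCount τ i then none
        else partitionAlg τ ts (avail - procCount τ i) (Function.update A i (procCount τ i))
      else none

end Analysis

/-- A vertex of a job: the task, the index of the job of that task, the vertex. -/
structure JobVertex {ι : Type w} {Θ : Type v} (τ : ι → DAGTask.{u, v} Θ) where
  task : ι
  job : ℕ
  vertex : (τ task).V

/-- A code segment accessing `res`: it starts when the vertex has executed for `start` time units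
and it takes `dur` time units of execution. -/
structure LockSection (Θ : Type v) where
  res : Θ
  start : ℝ
  dur : ℝ

/-- The data of a run of the system on `m` processors over the whole time line. -/
structure Run {ι : Type w} {Θ : Type v} (τ : ι → DAGTask.{u, v} Θ) (m : ℕ) where
  /-- Release time of each job. -/
  release : ι → ℕ → ℝ
  /-- Actual execution demand of each vertex of each job. -/
  exec : JobVertex τ → ℝ
  /-- The lock-protected code segments of each vertex of each job. -/
  sections : JobVertex τ → List (LockSection Θ)
  /-- What each processor is busy with at each time (`none`: idle). -/
  proc : Fin m → ℝ → Option (JobVertex τ)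
  /-- Who holds each lock at each time (`none`: the lock is free). -/
  holder : Θ → ℝ → Option (JobVertex τ)
  /-- Amount of execution that a vertex has received before a time. -/
  progress : JobVertex τ → ℝ → ℝ

namespace Run

variable {ι : Type w} {Θ : Type v} {τ : ι → DAGTask.{u, v} Θ} {m : ℕ}

/-- Some processor is busy with `x` at time `t`. -/
def Busy (R : Run τ m) (x : JobVertex τ) (t : ℝ) : Prop := ∃ p, R.proc p t = some x

/-- The execution of `x` has reached the code segment `s` (its first instant included) and has
not yet completed it. -/
def InSection (R : Run τ m) (x : JobVertex τ) (s : LockSection Θ) (t : ℝ) : Prop :=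
  s ∈ R.sections x ∧ s.start ≤ R.progress x t ∧ R.progress x t < s.start + s.dur

/-- `x` is spinning for `q`: it occupies a processor, is at a segment accessing `q`, and does not
hold the lock. -/
def Spinning (R : Run τ m) (x : JobVertex τ) (q : Θ) (t : ℝ) : Prop :=
  R.Busy x t ∧ (∃ s, R.InSection x s t ∧ s.res = q) ∧ R.holder q t ≠ some x

/-- `x` is executing: it occupies a processor and does not spin. -/
def Executing (R : Run τ m) (x : JobVertex τ) (t : ℝ) : Prop :=
  R.Busy x t ∧ ∀ q, ¬ R.Spinning x q t

/-- `x` has received its whole execution demand. -/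
def Done (R : Run τ m) (x : JobVertex τ) (t : ℝ) : Prop := R.exec x ≤ R.progress x t

/-- `x` is eligible: its job is released and its predecessors are finished. The condition is on
direct and indirect predecessors, because vertices without any execution demand (such as dummy
vertices) are `Done` from the start. -/
def Eligible (R : Run τ m) (x : JobVertex τ) (t : ℝ) : Prop :=
  R.release x.task x.job ≤ t ∧
    ∀ a, Relation.TransGen (τ x.task).edge a x.vertex → R.Done ⟨x.task, x.job, a⟩ t

/-- The behaviours that the model admits when task `i` is given the processors `P i`, with
spin locks served in an arbitrary order. -/
structure Legal [DecidableEq Θ] (R : Run τ m) (P : ι → Finset (Fin m)) : Prop where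
  release_sep : ∀ i k, R.release i k + (τ i).T ≤ R.release i (k + 1)
  exec_nonneg : ∀ x, 0 ≤ R.exec x
  exec_le_wcet : ∀ x, R.exec x ≤ (τ x.task).wcet x.vertex
  /-- Each access takes a positive time, at most `L`, and lies within the execution. -/
  section_bounds : ∀ x, ∀ s ∈ R.sections x,
    0 ≤ s.start ∧ 0 < s.dur ∧ s.dur ≤ (τ x.task).L s.res ∧ s.start + s.dur ≤ R.exec x
  /-- Locks are not nested. -/
  section_disjoint : ∀ x, (R.sections x).Pairwise (fun s s' => s.start + s.dur ≤ s'.start)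
  /-- Each job accesses `q` at most `N` times. -/
  access_count : ∀ i k q,
    ∑ a, ((R.sections ⟨i, k, a⟩).filter (fun s => s.res = q)).length ≤ (τ i).N q
  measurable_proc : ∀ p x, MeasurableSet {t | R.proc p t = some x}
  measurable_holder : ∀ q x, MeasurableSet {t | R.holder q t = some x}
  progress_eq : ∀ x t, R.progress x t =
    (volume {s | R.release x.task x.job ≤ s ∧ s < t ∧ R.Executing x s}).toReal
  /-- Each task runs on its own processors only. -/
  proc_mem : ∀ p t x, R.proc p t = some x → p ∈ P x.task
  /-- A vertex occupies at most one processor at a time. -/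
  proc_inj : ∀ p p' t x, R.proc p t = some x → R.proc p' t = some x → p = p'
  /-- Only eligible unfinished vertices run. -/
  busy_eligible : ∀ x t, R.Busy x t → R.Eligible x t ∧ ¬ R.Done x t
  /-- Work conservation: no processor of a task is idle while an eligible unfinished vertex of
  this task is waiting for a processor. -/
  work_conserving : ∀ x t, R.Eligible x t → ¬ R.Done x t → ¬ R.Busy x t →
    ∀ p ∈ P x.task, R.proc p t ≠ none
  /-- A lock is held only by a running vertex that is at a segment accessing its resource. -/
  holder_spec : ∀ q t x, R.holder q t = some x →
    R.Busy x t ∧ ∃ s, R.InSection x s t ∧ s.res = q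
  /-- A lock that has been obtained is kept until the end of the segment. -/
  holder_keep : ∀ x s t t', R.InSection x s t → R.holder s.res t = some x → t ≤ t' →
    R.InSection x s t' → R.holder s.res t' = some x
  /-- Spinning and holding are non-preemptive. -/
  nonpreemptive : ∀ x s t t', R.InSection x s t → R.Busy x t → t ≤ t' →
    R.InSection x s t' → R.Busy x t'
  /-- A vertex spins only while the lock is held. -/
  spin_held : ∀ x q t, R.Spinning x q t → R.holder q t ≠ none

/-- Finish time `f(J)` of the `k`-th job of task `i` (`⊤` if it never finishes). -/
def finish (R : Run τ m) (i : ι) (k : ℕ) : EReal :=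
  sInf (Real.toEReal '' {t | R.release i k ≤ t ∧ ∀ a, R.Done ⟨i, k, a⟩ t})

/-- Response time `R(J) = f(J) - r(J)`. -/
def responseTime (R : Run τ m) (i : ι) (k : ℕ) : EReal :=
  R.finish i k - (R.release i k : EReal)

/-- Worst-case response time of task `i` over all its jobs. -/
def wcrt (R : Run τ m) (i : ι) : EReal := ⨆ k, R.responseTime i k

/-- Task `i` is schedulable in the run: `R_i ≤ D_i`. -/
def Schedulable (R : Run τ m) (i : ι) : Prop := R.wcrt i ≤ ((τ i).D : EReal)

end Run

end

/-!
Otherwise, since the absolute deadlines tend to infinity, some job `J` misses its deadline while all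
jobs with earlier deadlines meet theirs. As `D ≤ T`, no other job of its task is pending in the
window of `J` from release to deadline. Choose a path from head to tail backwards, from an
unfinished vertex to an ancestor that finishes last. At each instant of the window,

* another task holds a lock that the task of `J` uses, or
* some vertex of `J` executes, and `J` holds a lock or a vertex of the path executes, or
* the current vertex of the path waits, and all `M` processors of the task execute `J`.

The first case lasts at most `inter`, by counting the jobs whose deadlines are after the release of
`J`; the second lasts at most `intra + longest`. Weighing them by `M` and `M - 1`, and each vertex
of `J` by `1` while it executes, gives the Graham-type bound
`M * D ≤ M * inter + (M - 1) * (intra + longest) + work`, where the executed work is less than `C`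
as `J` is unfinished. This contradicts `C - (longest + intra) ≤ M * slack`, which is how the number
of processors is chosen.
-/

section SeparatedSequences

variable {𝕜 : Type*} [Field 𝕜] [LinearOrder 𝕜] [IsStrictOrderedRing 𝕜] {f : ℕ → 𝕜} {T : 𝕜}

lemma sub_mul_le_sub_of_add_le_succ (hf : ∀ k, f k + T ≤ f (k + 1)) {k l : ℕ} (hkl : k ≤ l) :
    ((l : 𝕜) - k) * T ≤ f l - f k := by
  have hmono : Monotone fun n : ℕ => f n - n * T := monotone_nat_of_le_succ fun n => by
    push_cast
    linarith [hf n]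
  linarith [hmono hkl]

lemma tendsto_atTop_of_add_le_succ [Archimedean 𝕜] (hT : 0 < T)
    (hf : ∀ k, f k + T ≤ f (k + 1)) : Filter.Tendsto f Filter.atTop Filter.atTop := by
  refine Filter.tendsto_atTop_mono (f := fun k : ℕ => f 0 + k * T) (fun k => ?_)
    (Filter.tendsto_atTop_add_const_left _ _
      (tendsto_natCast_atTop_atTop.atTop_mul_const hT))
  have hgap := sub_mul_le_sub_of_add_le_succ hf k.zero_le
  simp only [Nat.cast_zero, sub_zero] at hgap
  linarith

lemma card_le_ceil_of_add_le_succ [FloorSemiring 𝕜] (hT : 0 < T)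
    (hf : ∀ k, f k + T ≤ f (k + 1)) {a b : 𝕜} {K : Finset ℕ} (hK : ∀ k ∈ K, f k ∈ Set.Ioo a b) :
    K.card ≤ ⌈(b - a) / T⌉₊ := by
  rcases K.eq_empty_or_nonempty with rfl | hne
  · simp
  have hle : K.min' hne ≤ K.max' hne := K.min'_le _ (K.max'_mem hne)
  have hcard : K.card ≤ K.max' hne - K.min' hne + 1 := by
    have hsub : K ⊆ Finset.Icc (K.min' hne) (K.max' hne) := fun k hk =>
      Finset.mem_Icc.2 ⟨K.min'_le _ hk, K.le_max' _ hk⟩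
    have hIcc := Finset.card_le_card hsub
    rw [Nat.card_Icc] at hIcc
    omega
  refine hcard.trans (Nat.lt_ceil.2 ?_)
  rw [lt_div_iff₀ hT, Nat.cast_sub hle]
  linarith [sub_mul_le_sub_of_add_le_succ hf hle, (hK _ (K.min'_mem hne)).1,
    (hK _ (K.max'_mem hne)).2]

end SeparatedSequences

section MeasureBounds

lemma card_le_sum_indicator_one {α V : Type*} [Fintype V] {E : V → Set α} {t : α} {s : Finset V}
    (hs : ∀ a ∈ s, t ∈ E a) : (s.card : ℝ) ≤ ∑ a, (E a).indicator (fun _ => (1 : ℝ)) t := by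
  calc (s.card : ℝ) = ∑ a ∈ s, (E a).indicator (fun _ => (1 : ℝ)) t := by
        simp [Finset.sum_congr rfl fun a ha => Set.indicator_of_mem (hs a ha) _]
    _ ≤ ∑ a, (E a).indicator (fun _ => (1 : ℝ)) t :=
      Finset.sum_le_sum_of_subset_of_nonneg (Finset.subset_univ s) fun a _ _ =>
        Set.indicator_nonneg (fun _ _ => zero_le_one) t

variable {α : Type*} [MeasurableSpace α]

-- The sets need not be measurable: measurable hulls have the same measures and only enlarge the
-- right-hand side of the hypothesis.
lemma mul_measureReal_univ_le_sum_mul_measureReal {κ : Type*} [Fintype κ] (μ : Measure α)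
    [IsFiniteMeasure μ] (A : κ → Set α) {w : κ → ℝ} (hw : ∀ k, 0 ≤ w k) {c : ℝ}
    (hcover : ∀ᵐ t ∂μ, c ≤ ∑ k, (A k).indicator (fun _ => w k) t) :
    c * μ.real Set.univ ≤ ∑ k, w k * μ.real (A k) := by
  have hmeas k : MeasurableSet (toMeasurable μ (A k)) := measurableSet_toMeasurable μ (A k)
  have hint k : Integrable ((toMeasurable μ (A k)).indicator fun _ => w k) μ :=
    (integrable_const (w k)).indicator (hmeas k)
  calc c * μ.real Set.univ = ∫ _, c ∂μ := by rw [integral_const, smul_eq_mul, mul_comm]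
    _ ≤ ∫ t, ∑ k, (toMeasurable μ (A k)).indicator (fun _ => w k) t ∂μ :=
      integral_mono_ae (integrable_const c) (integrable_finsetSum _ fun k _ => hint k) <|
        hcover.mono fun t ht => ht.trans <| Finset.sum_le_sum fun k _ =>
          Set.indicator_le_indicator_of_subset (subset_toMeasurable μ (A k)) (fun _ => hw k) t
    _ = ∑ k, w k * μ.real (A k) := by
      rw [integral_finsetSum _ fun k _ => hint k]
      exact Finset.sum_congr rfl fun k _ => by
        rw [integral_indicator_const (w k) (hmeas k), smul_eq_mul, mul_comm, measureReal_def,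
          measure_toMeasurable, measureReal_def]

-- Graham-type list scheduling bound with blocking: read `B` as the blocked time, `Q` as the
-- time when a critical activity progresses, and `E a` as the time when the vertex `a` executes.
lemma mul_measureReal_univ_le_of_card_le {V : Type*} [Fintype V] (μ : Measure α)
    [IsFiniteMeasure μ] (B Q : Set α) (E : V → Set α) {M : ℕ} (hM : 1 ≤ M)
    (hcover : ∀ᵐ t ∂μ, t ∈ B ∨ (t ∈ Q ∧ ∃ a, t ∈ E a) ∨
      ∃ s : Finset V, M ≤ s.card ∧ ∀ a ∈ s, t ∈ E a) :
    M * μ.real Set.univ ≤ M * μ.real B + (M - 1) * μ.real Q + ∑ a, μ.real (E a) := by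
  have hM' : (0 : ℝ) ≤ M - 1 := sub_nonneg.2 (Nat.one_le_cast.2 hM)
  have hweighted := mul_measureReal_univ_le_sum_mul_measureReal μ (c := M)
    (fun k : Option (Option V) => k.elim B fun k => k.elim Q E)
    (w := fun k => k.elim (M : ℝ) fun k => k.elim (M - 1 : ℝ) 1)
    (by rintro (_ | _ | _) <;> simp [hM']) <| by
      filter_upwards [hcover] with t ht
      simp only [Fintype.sum_option, Option.elim_none, Option.elim_some, Pi.one_apply]
      have hB₀ : 0 ≤ B.indicator (fun _ => (M : ℝ)) t :=
        Set.indicator_nonneg (fun _ _ => M.cast_nonneg) t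
      have hQ₀ : 0 ≤ Q.indicator (fun _ => (M - 1 : ℝ)) t := Set.indicator_nonneg (fun _ _ => hM') t
      rcases ht with hB | ⟨hQ, a, ha⟩ | ⟨s, hs, hsE⟩
      · have hE₀ := card_le_sum_indicator_one (E := E) (t := t) (s := ∅) (by simp)
        rw [Set.indicator_of_mem hB]
        rw [Finset.card_empty, Nat.cast_zero] at hE₀
        linarith
      · have hE₁ := card_le_sum_indicator_one (E := E) (t := t) (s := {a}) (by simpa using ha)
        rw [Set.indicator_of_mem hQ]
        rw [Finset.card_singleton, Nat.cast_one] at hE₁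
        linarith
      · have hEs := card_le_sum_indicator_one hsE
        have hMs : (M : ℝ) ≤ s.card := Nat.cast_le.2 hs
        linarith
  simp only [Fintype.sum_option, Option.elim_none, Option.elim_some, Pi.one_apply,
    one_mul] at hweighted
  linarith

end MeasureBounds

section Occupation

/-- The total time during which `E` has held before `t`: the service received by time `t` by a
vertex that executes during `E`. -/
noncomputable def occupation (E : Set ℝ) (t : ℝ) : ℝ := volume.real (E ∩ Set.Iio t)

variable {E : Set ℝ}

lemma volume_real_inter_Ico_eq_occupation_sub (hE : BddBelow E) {t t' : ℝ} (htt : t ≤ t') :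
    volume.real (E ∩ Set.Ico t t') = occupation E t' - occupation E t := by
  obtain ⟨r, hr⟩ := hE
  have hsub : E ∩ Set.Iio t' ⊆ Set.Ico r t' := fun s hs => ⟨hr hs.1, hs.2⟩
  have hsplit := measureReal_inter_add_sdiff (t := Set.Iio t) measurableSet_Iio
    (measure_ne_top_of_subset (μ := volume) hsub (by simp))
  have hbefore : E ∩ Set.Iio t' ∩ Set.Iio t = E ∩ Set.Iio t := by
    rw [Set.inter_assoc, Set.Iio_inter_Iio, min_eq_right htt]
  have hafter : (E ∩ Set.Iio t') \ Set.Iio t = E ∩ Set.Ico t t' := by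
    ext s
    simp only [Set.mem_sdiff, Set.mem_inter_iff, Set.mem_Iio, Set.mem_Ico, not_lt]
    tauto
  rw [hbefore, hafter] at hsplit
  exact eq_sub_of_add_eq' hsplit

lemma occupation_mono (hE : BddBelow E) : Monotone (occupation E) := fun _ _ htt =>
  sub_nonneg.1 <| volume_real_inter_Ico_eq_occupation_sub hE htt ▸ measureReal_nonneg

lemma occupation_eq_zero {t : ℝ} (ht : ∀ s ∈ E, t ≤ s) : occupation E t = 0 := by
  have hempty : E ∩ Set.Iio t = ∅ :=
    Set.eq_empty_of_forall_notMem fun s hs => (ht s hs.1).not_gt hs.2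
  rw [occupation, hempty, measureReal_empty]

lemma continuous_occupation (hE : BddBelow E) : Continuous (occupation E) := by
  refine (LipschitzWith.of_le_add_mul 1 fun t t' => ?_).continuous
  rw [NNReal.coe_one, one_mul, ← sub_le_iff_le_add']
  rcases le_total t t' with htt | htt
  · exact (sub_nonpos.2 (occupation_mono hE htt)).trans dist_nonneg
  · calc occupation E t - occupation E t' = volume.real (E ∩ Set.Ico t' t) :=
        (volume_real_inter_Ico_eq_occupation_sub hE htt).symm
      _ ≤ volume.real (Set.Ico t' t) := measureReal_mono Set.inter_subset_right (by simp)
      _ = dist t t' := by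
        rw [Real.volume_real_Ico_of_le htt, Real.dist_eq, abs_of_nonneg (sub_nonneg.2 htt)]

lemma volume_real_inter_occupation_preimage_Icc_le (hE : BddBelow E) {a b : ℝ} (hab : a ≤ b)
    (r d : ℝ) :
    (volume.restrict (Set.Ico r d)).real (E ∩ occupation E ⁻¹' Set.Icc a b) ≤ b - a := by
  set S := Set.Icc r d ∩ occupation E ⁻¹' Set.Icc a b
  have hsubS : E ∩ occupation E ⁻¹' Set.Icc a b ∩ Set.Ico r d ⊆ E ∩ S := fun t ht =>
    ⟨ht.1.1, Set.Ico_subset_Icc_self ht.2, ht.1.2⟩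
  rw [measureReal_restrict_apply' measurableSet_Ico]
  rcases S.eq_empty_or_nonempty with hempty | hne
  · rw [Set.eq_empty_of_subset_empty (hsubS.trans (by simp [hempty])), measureReal_empty]
    exact sub_nonneg.2 hab
  have hcompact : IsCompact S :=
    isCompact_Icc.inter_right (isClosed_Icc.preimage (continuous_occupation hE))
  obtain ⟨u, hu⟩ := hcompact.exists_isLeast hne
  obtain ⟨v, hv⟩ := hcompact.exists_isGreatest hne
  calc volume.real (E ∩ occupation E ⁻¹' Set.Icc a b ∩ Set.Ico r d)
      ≤ volume.real (E ∩ Set.Icc u v) :=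
        measureReal_mono (fun t ht => ⟨ht.1.1, hu.2 (hsubS ht).2, hv.2 (hsubS ht).2⟩)
          (measure_ne_top_of_subset Set.inter_subset_right (by simp))
    _ = volume.real (E ∩ Set.Ico u v) :=
        measureReal_congr ((ae_eq_refl E).inter Ico_ae_eq_Icc.symm)
    _ = occupation E v - occupation E u :=
        volume_real_inter_Ico_eq_occupation_sub hE (hv.2 hu.1)
    _ ≤ b - a := sub_le_sub hv.1.2.2 hu.1.2.1

end Occupation

lemma exists_isChain_append_getLast?_eq {α : Type*} {r : α → α → Prop} {π : List α} {a b : α}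
    (hπ : π.IsChain r) (ha : π.getLast? = some a) (hab : Relation.ReflTransGen r a b) :
    ∃ l, (π ++ l).IsChain r ∧ (π ++ l).getLast? = some b := by
  induction hab with
  | refl => exact ⟨[], by simpa using hπ, by simpa using ha⟩
  | @tail b c _ hbc ih =>
    obtain ⟨l, hl, hb⟩ := ih
    refine ⟨l ++ [c], ?_, by simp⟩
    rw [← List.append_assoc]
    exact hl.append (List.isChain_singleton c) (by simpa [hb] using hbc)

namespace DAGTask

variable {Θ : Type v}

lemma T_pos (τ : DAGTask.{u, v} Θ) : 0 < τ.T := τ.D_pos.trans_le τ.D_le_T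

lemma mem_resources [Fintype Θ] {τ : DAGTask.{u, v} Θ} {q : Θ} :
    q ∈ τ.resources ↔ τ.Accesses q := by
  simp [resources]

lemma wellFounded_transGen_edge (τ : DAGTask.{u, v} Θ) :
    WellFounded (Relation.TransGen τ.edge) :=
  have : Std.Irrefl (Relation.TransGen τ.edge) := ⟨τ.acyclic⟩
  Finite.wellFounded_of_trans_of_irrefl _

lemma wellFounded_swap_transGen_edge (τ : DAGTask.{u, v} Θ) :
    WellFounded (Function.swap (Relation.TransGen τ.edge)) :=
  have : Std.Irrefl (Function.swap (Relation.TransGen τ.edge)) := ⟨τ.acyclic⟩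
  Finite.wellFounded_of_trans_of_irrefl _

lemma reflTransGen_edge_tail (τ : DAGTask.{u, v} Θ) (a : τ.V) :
    Relation.ReflTransGen τ.edge a τ.tail := by
  induction a using τ.wellFounded_swap_transGen_edge.induction with
  | _ a ih =>
    by_cases ha : ∀ b, ¬ τ.edge a b
    · rw [(τ.tail_iff a).1 ha]
    · push Not at ha
      obtain ⟨b, hb⟩ := ha
      exact (ih b (.single hb)).head hb

variable {τ : DAGTask.{u, v} Θ}

lemma nodup_of_isChain_edge {π : List τ.V} (hπ : π.IsChain τ.edge) : π.Nodup := by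
  have hpairwise : π.Pairwise (Relation.TransGen τ.edge) :=
    List.isChain_iff_pairwise.1 (hπ.imp fun _ _ => .single)
  refine hpairwise.imp ?_
  rintro a _ hab rfl
  exact τ.acyclic a hab

lemma len_eq_sum_toFinset [DecidableEq τ.V] {π : List τ.V} (hπ : π.IsChain τ.edge) :
    τ.len π = ∑ a ∈ π.toFinset, τ.wcet a :=
  (List.sum_toFinset _ (nodup_of_isChain_edge hπ)).symm

lemma len_le_longest {π : List τ.V} (hπ : τ.IsCompletePath π) : τ.len π ≤ τ.longest := by
  classical
  refine le_csSup ⟨τ.totalWork, ?_⟩ ⟨π, hπ, rfl⟩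
  rintro _ ⟨π', hπ', rfl⟩
  rw [len_eq_sum_toFinset hπ'.1]
  exact Finset.sum_le_sum_of_subset_of_nonneg (Finset.subset_univ _) fun a _ _ => τ.wcet_nonneg a

variable {𝕋 : Type*} [LinearOrder 𝕋] {U : τ.V → Set 𝕋}

-- Read `U a` as the set of times at which `a` is unfinished. The path is built backwards, from a
-- vertex to an ancestor that is the last one to finish.
lemma exists_isChain_forall_mem_exists_ready (hU : ∀ a, IsLowerSet (U a)) (b : τ.V) :
    ∃ π : List τ.V, π.IsChain τ.edge ∧ π.head? = some τ.head ∧ π.getLast? = some b ∧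
      ∀ t ∈ U b, ∃ a ∈ π, t ∈ U a ∧ ∀ c, Relation.TransGen τ.edge c a → t ∉ U c := by
  induction b using τ.wellFounded_transGen_edge.induction with
  | _ b ih =>
    by_cases hb : ∀ a, ¬ Relation.TransGen τ.edge a b
    · have hhead : b = τ.head := (τ.head_iff b).1 fun a hab => hb a (.single hab)
      exact ⟨[b], List.isChain_singleton _, by simp [hhead], rfl,
        fun t ht => ⟨b, by simp, ht, fun c hc => absurd hc (hb c)⟩⟩
    · push Not at hb
      obtain ⟨a, hab, hlast⟩ :=
        Set.Finite.exists_maximalFor U {a | Relation.TransGen τ.edge a b} (Set.toFinite _) hb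
      obtain ⟨π, hπ, hhead, ha, hready⟩ := ih a hab
      obtain ⟨l, hl, hlb⟩ := exists_isChain_append_getLast?_eq hπ ha hab.to_reflTransGen
      refine ⟨π ++ l, hl, by simp [hhead], hlb, fun t ht => ?_⟩
      by_cases hta : t ∈ U a
      · obtain ⟨x, hx, hx_ready⟩ := hready t hta
        exact ⟨x, List.mem_append_left l hx, hx_ready⟩
      · refine ⟨b, List.mem_of_getLast? hlb, ht, fun c hc htc => hta ?_⟩
        rcases (hU a).total (hU c) with hac | hca
        · exact hlast hc hac htc
        · exact hca htc

lemma exists_isCompletePath_forall_mem_exists_ready (hU : ∀ a, IsLowerSet (U a)) (b : τ.V) :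
    ∃ π : List τ.V, τ.IsCompletePath π ∧
      ∀ t ∈ U b, ∃ a ∈ π, t ∈ U a ∧ ∀ c, Relation.TransGen τ.edge c a → t ∉ U c := by
  obtain ⟨π, hπ, hhead, hb, hready⟩ := exists_isChain_forall_mem_exists_ready hU b
  obtain ⟨l, hl, htail⟩ := exists_isChain_append_getLast?_eq hπ hb (τ.reflTransGen_edge_tail b)
  refine ⟨π ++ l, ⟨hl, by simp [hhead], htail⟩, fun t ht => ?_⟩
  obtain ⟨a, ha, ha_ready⟩ := hready t ht
  exact ⟨a, List.mem_append_left l ha, ha_ready⟩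

end DAGTask

section Analysis

variable {ι : Type w} {Θ : Type v} [Fintype Θ] [Fintype ι] [DecidableEq ι]
  {τ : ι → DAGTask.{u, v} Θ} {i : ι}

lemma interTerm_nonneg : 0 ≤ interTerm τ i :=
  Finset.sum_nonneg fun j _ => Finset.sum_nonneg fun q _ =>
    mul_nonneg (mul_nonneg (Nat.cast_nonneg _) (Nat.cast_nonneg _)) ((τ j).L_nonneg q)

lemma procCount_le_iff (hS : 0 < slack τ i) {n : ℕ} :
    procCount τ i ≤ n ↔ (τ i).totalWork - ((τ i).longest + intraTerm τ i) ≤ n * slack τ i := by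
  rw [procCount, Nat.ceil_le, div_le_iff₀ hS]

lemma procCount_pos (hdens : 1 < (τ i).density) (hS : 0 < slack τ i) : 0 < procCount τ i := by
  have hwork : (τ i).D < (τ i).totalWork := (one_lt_div₀ (τ i).D_pos).1 hdens
  refine Nat.ceil_pos.2 (div_pos ?_ hS)
  have hinter := interTerm_nonneg (τ := τ) (i := i)
  unfold slack at hS
  linarith

end Analysis

namespace Run

section

variable {ι : Type w} {Θ : Type v} {τ : ι → DAGTask.{u, v} Θ} {m : ℕ}

/-- Absolute deadline of the `k`-th job of task `i`. -/
def deadline (R : Run τ m) (i : ι) (k : ℕ) : ℝ := R.release i k + (τ i).D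

/-- The time window from the release of a job to its absolute deadline. -/
abbrev window (R : Run τ m) (i : ι) (k : ℕ) : Set ℝ := Set.Ico (R.release i k) (R.deadline i k)

/-- The `k`-th job of task `i` is finished at its absolute deadline. -/
def MeetsDeadline (R : Run τ m) (i : ι) (k : ℕ) : Prop := ∀ a, R.Done ⟨i, k, a⟩ (R.deadline i k)

/-- The `k`-th job of task `j` holds the lock of `q`. -/
def JobHolds (R : Run τ m) (j : ι) (k : ℕ) (q : Θ) (t : ℝ) : Prop :=
  ∃ a, R.holder q t = some ⟨j, k, a⟩

/-- Some job of task `j` holds the lock of `q`. -/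
def TaskHolds (R : Run τ m) (j : ι) (q : Θ) (t : ℝ) : Prop := ∃ k, R.JobHolds j k q t

/-- Another task holds a lock that task `i` uses: the source of inter-task blocking. -/
def RemotelyHeld (R : Run τ m) (i : ι) (t : ℝ) : Prop :=
  ∃ j ≠ i, ∃ q, (τ i).Accesses q ∧ R.TaskHolds j q t

/-- The `k`-th job of task `i` itself holds a lock: the source of intra-task blocking. -/
def LocallyHeld (R : Run τ m) (i : ι) (k : ℕ) (t : ℝ) : Prop :=
  ∃ q, (τ i).Accesses q ∧ R.JobHolds i k q t

lemma release_le_deadline (R : Run τ m) (i : ι) (k : ℕ) : R.release i k ≤ R.deadline i k :=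
  le_add_of_nonneg_right (τ i).D_pos.le

end

namespace Legal

variable {ι : Type w} {Θ : Type v} {τ : ι → DAGTask.{u, v} Θ} {m : ℕ} [DecidableEq Θ]
  {R : Run τ m} {P : ι → Finset (Fin m)}

section Progress

lemma bddBelow_executing (h : R.Legal P) (x : JobVertex τ) : BddBelow {t | R.Executing x t} :=
  ⟨R.release x.task x.job, fun t ht => (h.busy_eligible x t ht.1).1.1⟩

lemma progress_eq_occupation (h : R.Legal P) (x : JobVertex τ) :
    R.progress x = occupation {t | R.Executing x t} := by
  ext t
  rw [h.progress_eq, occupation, measureReal_def]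
  congr 2
  ext s
  exact ⟨fun ⟨_, hst, hs⟩ => ⟨hs, hst⟩, fun ⟨hs, hst⟩ => ⟨(h.busy_eligible x s hs.1).1.1, hst, hs⟩⟩

lemma progress_mono (h : R.Legal P) (x : JobVertex τ) : Monotone (R.progress x) :=
  h.progress_eq_occupation x ▸ occupation_mono (h.bddBelow_executing x)

lemma continuous_progress (h : R.Legal P) (x : JobVertex τ) : Continuous (R.progress x) :=
  h.progress_eq_occupation x ▸ continuous_occupation (h.bddBelow_executing x)

lemma progress_eq_zero (h : R.Legal P) {x : JobVertex τ} {t : ℝ}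
    (ht : t ≤ R.release x.task x.job) : R.progress x t = 0 :=
  h.progress_eq_occupation x ▸
    occupation_eq_zero fun s hs => ht.trans (h.busy_eligible x s hs.1).1.1

lemma done_mono (h : R.Legal P) {x : JobVertex τ} {t t' : ℝ} (htt : t ≤ t') (ht : R.Done x t) :
    R.Done x t' :=
  ht.trans (h.progress_mono x htt)

lemma progress_le_exec (h : R.Legal P) (x : JobVertex τ) (t : ℝ) : R.progress x t ≤ R.exec x := by
  by_contra! hlt
  have hrt : R.release x.task x.job ≤ t := by
    by_contra! htr
    exact (h.exec_nonneg x).not_gt (h.progress_eq_zero htr.le ▸ hlt)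
  obtain ⟨t₁, ⟨-, ht₁⟩, hdone⟩ := intermediate_value_Icc hrt (h.continuous_progress x).continuousOn
    ⟨(h.progress_eq_zero le_rfl).trans_le (h.exec_nonneg x), hlt.le⟩
  have hidle : {s | R.Executing x s} ∩ Set.Ico t₁ t = ∅ :=
    Set.eq_empty_of_forall_notMem fun s ⟨hs, hts⟩ =>
      (h.busy_eligible x s hs.1).2 (h.done_mono hts.1 hdone.ge)
  have hsame := volume_real_inter_Ico_eq_occupation_sub (h.bddBelow_executing x) ht₁
  rw [hidle, measureReal_empty, ← h.progress_eq_occupation] at hsame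
  linarith

lemma progress_le_wcet (h : R.Legal P) (x : JobVertex τ) (t : ℝ) :
    R.progress x t ≤ (τ x.task).wcet x.vertex :=
  (h.progress_le_exec x t).trans (h.exec_le_wcet x)

lemma volume_real_executing_window (h : R.Legal P) (i : ι) (k : ℕ) (a : (τ i).V) :
    (volume.restrict (R.window i k)).real {t | R.Executing ⟨i, k, a⟩ t} =
      R.progress ⟨i, k, a⟩ (R.deadline i k) := by
  rw [measureReal_restrict_apply' measurableSet_Ico,
    volume_real_inter_Ico_eq_occupation_sub (h.bddBelow_executing _)
      (R.release_le_deadline i k),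
    ← h.progress_eq_occupation, h.progress_eq_zero le_rfl, sub_zero]

lemma volume_real_executing_inter_progress_preimage_Icc_le (h : R.Legal P) (x : JobVertex τ)
    {a b : ℝ} (hab : a ≤ b) (r d : ℝ) :
    (volume.restrict (Set.Ico r d)).real
      ({t | R.Executing x t} ∩ R.progress x ⁻¹' Set.Icc a b) ≤ b - a :=
  h.progress_eq_occupation x ▸
    volume_real_inter_occupation_preimage_Icc_le (h.bddBelow_executing x) hab r d

lemma volume_real_exists_mem_executing_le_longest (h : R.Legal P) (i : ι) (k : ℕ)
    {π : List (τ i).V} (hπ : (τ i).IsCompletePath π) :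
    (volume.restrict (R.window i k)).real {t | ∃ a ∈ π, R.Executing ⟨i, k, a⟩ t} ≤
      (τ i).longest := by
  classical
  have hunion : {t | ∃ a ∈ π, R.Executing ⟨i, k, a⟩ t} =
      ⋃ a ∈ π.toFinset, {t | R.Executing ⟨i, k, a⟩ t} := by
    ext t
    simp
  calc _ ≤ ∑ a ∈ π.toFinset, (volume.restrict (R.window i k)).real
          {t | R.Executing ⟨i, k, a⟩ t} := hunion ▸ measureReal_biUnion_finset_le _ _
    _ ≤ ∑ a ∈ π.toFinset, (τ i).wcet a := Finset.sum_le_sum fun a _ =>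
      (h.volume_real_executing_window i k a).trans_le (h.progress_le_wcet ⟨i, k, a⟩ _)
    _ = (τ i).len π := (DAGTask.len_eq_sum_toFinset hπ.1).symm
    _ ≤ (τ i).longest := DAGTask.len_le_longest hπ

end Progress

section Locks

lemma inSection_unique (h : R.Legal P) {x : JobVertex τ} {s s' : LockSection Θ} {t : ℝ}
    (hs : R.InSection x s t) (hs' : R.InSection x s' t) : s = s' := by
  by_contra hne
  let Separated (s s' : LockSection Θ) : Prop :=
    s.start + s.dur ≤ s'.start ∨ s'.start + s'.dur ≤ s.start
  have : Std.Symm Separated := ⟨fun _ _ => Or.symm⟩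
  have hsep : (R.sections x).Pairwise Separated := (h.section_disjoint x).imp Or.inl
  obtain ⟨hmem, hstart, hend⟩ := hs
  obtain ⟨hmem', hstart', hend'⟩ := hs'
  rcases hsep.forall hmem hmem' hne with hlt | hlt <;> linarith

lemma executing_of_holder (h : R.Legal P) {x : JobVertex τ} {q : Θ} {t : ℝ}
    (hx : R.holder q t = some x) : R.Executing x t := by
  obtain ⟨hbusy, s, hs, rfl⟩ := h.holder_spec q t x hx
  refine ⟨hbusy, ?_⟩
  rintro _ ⟨-, ⟨s', hs', rfl⟩, hne⟩
  exact hne (h.inSection_unique hs hs' ▸ hx)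

lemma accesses_of_mem_sections (h : R.Legal P) {x : JobVertex τ} {s : LockSection Θ}
    (hs : s ∈ R.sections x) : (τ x.task).Accesses s.res := by
  let count (a : (τ x.task).V) : ℕ :=
    ((R.sections ⟨x.task, x.job, a⟩).filter fun s' => s'.res = s.res).length
  calc 0 < count x.vertex := List.length_pos_of_mem (List.mem_filter.2 ⟨hs, by simp⟩)
    _ ≤ ∑ a, count a := Finset.single_le_sum (fun _ _ => Nat.zero_le _) (Finset.mem_univ x.vertex)
    _ ≤ (τ x.task).N s.res := h.access_count x.task x.job s.res

lemma accesses_of_holder (h : R.Legal P) {x : JobVertex τ} {q : Θ} {t : ℝ}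
    (hx : R.holder q t = some x) : (τ x.task).Accesses q := by
  obtain ⟨-, s, hs, rfl⟩ := h.holder_spec q t x hx
  exact h.accesses_of_mem_sections hs.1

lemma volume_real_holder_eq_le (h : R.Legal P) (x : JobVertex τ) (q : Θ) (r d : ℝ) :
    (volume.restrict (Set.Ico r d)).real {t | R.holder q t = some x} ≤
      ((R.sections x).filter fun s => s.res = q).length * (τ x.task).L q := by
  classical
  set F := ((R.sections x).filter fun s => s.res = q).toFinset
  have hF {s} : s ∈ F ↔ s ∈ R.sections x ∧ s.res = q := by simp [F]
  have hsub : {t | R.holder q t = some x} ⊆ ⋃ s ∈ F,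
      {t | R.Executing x t} ∩ R.progress x ⁻¹' Set.Icc s.start (s.start + s.dur) := by
    intro t ht
    obtain ⟨-, s, hs, hq⟩ := h.holder_spec q t x ht
    exact Set.mem_biUnion (hF.2 ⟨hs.1, hq⟩) ⟨h.executing_of_holder ht, hs.2.1, hs.2.2.le⟩
  calc _ ≤ _ := measureReal_mono hsub (measure_ne_top _ _)
    _ ≤ _ := measureReal_biUnion_finset_le _ _
    _ ≤ ∑ _s ∈ F, (τ x.task).L q := Finset.sum_le_sum fun s hs => by
      obtain ⟨hmem, rfl⟩ := hF.1 hs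
      obtain ⟨-, hpos, hL, -⟩ := h.section_bounds x s hmem
      have hvol := h.volume_real_executing_inter_progress_preimage_Icc_le x
        (le_add_of_nonneg_right hpos.le : s.start ≤ s.start + s.dur) r d
      linarith
    _ = F.card * (τ x.task).L q := by rw [Finset.sum_const, nsmul_eq_mul]
    _ ≤ _ := mul_le_mul_of_nonneg_right (Nat.cast_le.2 (List.toFinset_card_le _))
      ((τ x.task).L_nonneg q)

lemma volume_real_jobHolds_le (h : R.Legal P) (j : ι) (k : ℕ) (q : Θ) (r d : ℝ) :
    (volume.restrict (Set.Ico r d)).real {t | R.JobHolds j k q t} ≤ (τ j).N q * (τ j).L q := by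
  let count (a : (τ j).V) : ℕ := ((R.sections ⟨j, k, a⟩).filter fun s => s.res = q).length
  have hunion : {t | R.JobHolds j k q t} =
      ⋃ a ∈ (Finset.univ : Finset (τ j).V), {t | R.holder q t = some ⟨j, k, a⟩} := by
    ext t
    simp [JobHolds]
  calc _ ≤ ∑ a, (volume.restrict (Set.Ico r d)).real {t | R.holder q t = some ⟨j, k, a⟩} :=
        hunion ▸ measureReal_biUnion_finset_le _ _
    _ ≤ ∑ a, (count a : ℝ) * (τ j).L q :=
      Finset.sum_le_sum fun a _ => h.volume_real_holder_eq_le ⟨j, k, a⟩ q r d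
    _ = ((∑ a, count a : ℕ) : ℝ) * (τ j).L q := by rw [Nat.cast_sum, Finset.sum_mul]
    _ ≤ _ := mul_le_mul_of_nonneg_right (Nat.cast_le.2 (h.access_count j k q)) ((τ j).L_nonneg q)

lemma tendsto_release (h : R.Legal P) (i : ι) :
    Filter.Tendsto (R.release i) Filter.atTop Filter.atTop :=
  tendsto_atTop_of_add_le_succ (τ i).T_pos (h.release_sep i)

-- A job that holds the lock within `[r, d)` is released before `d` and is unfinished at some time
-- after `r`, so its deadline is after `r`; releases at distance `T` leave room for only
-- `⌈(d - r + D) / T⌉` such jobs.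
lemma volume_real_taskHolds_le (h : R.Legal P) (j : ι) (q : Θ) {r d : ℝ}
    (hmet : ∀ k, R.deadline j k < d → R.MeetsDeadline j k) :
    (volume.restrict (Set.Ico r d)).real {t | R.TaskHolds j q t} ≤
      ⌈(d - r + (τ j).D) / (τ j).T⌉₊ * (τ j).N q * (τ j).L q := by
  have hfin : {k | R.release j k ∈ Set.Ioo (r - (τ j).D) d}.Finite := by
    have hlate := (h.tendsto_release j).eventually_ge_atTop d
    rw [← Nat.cofinite_eq_atTop, Filter.eventually_cofinite] at hlate
    exact hlate.subset fun k hk => hk.2.not_ge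
  have hcard : hfin.toFinset.card ≤ ⌈(d - r + (τ j).D) / (τ j).T⌉₊ := by
    rw [sub_add]
    exact card_le_ceil_of_add_le_succ (τ j).T_pos (h.release_sep j) fun k hk =>
      hfin.mem_toFinset.1 hk
  have hsub : {t | R.TaskHolds j q t} ≤ᵐ[volume.restrict (Set.Ico r d)]
      ⋃ k ∈ hfin.toFinset, {t | R.JobHolds j k q t} := by
    filter_upwards [ae_restrict_mem measurableSet_Ico] with t ht
    rintro ⟨k, a, ha⟩
    obtain ⟨⟨hreleased, -⟩, hunfinished⟩ := h.busy_eligible _ _ (h.holder_spec q t _ ha).1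
    have hdeadline : t < R.deadline j k := by
      by_contra! hle
      exact hunfinished (h.done_mono hle (hmet k (hle.trans_lt ht.2) a))
    refine Set.mem_biUnion (hfin.mem_toFinset.2 ⟨?_, hreleased.trans_lt ht.2⟩) ⟨a, ha⟩
    exact sub_lt_iff_lt_add.2 (ht.1.trans_lt hdeadline)
  calc _ ≤ (volume.restrict (Set.Ico r d)).real (⋃ k ∈ hfin.toFinset, {t | R.JobHolds j k q t}) :=
        ENNReal.toReal_mono (measure_ne_top _ _) (measure_mono_ae hsub)
    _ ≤ ∑ k ∈ hfin.toFinset, (volume.restrict (Set.Ico r d)).real {t | R.JobHolds j k q t} :=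
      measureReal_biUnion_finset_le _ _
    _ ≤ ∑ _k ∈ hfin.toFinset, ((τ j).N q * (τ j).L q : ℝ) :=
      Finset.sum_le_sum fun k _ => h.volume_real_jobHolds_le j k q r d
    _ = hfin.toFinset.card * ((τ j).N q * (τ j).L q) := by rw [Finset.sum_const, nsmul_eq_mul]
    _ ≤ ⌈(d - r + (τ j).D) / (τ j).T⌉₊ * ((τ j).N q * (τ j).L q) :=
      mul_le_mul_of_nonneg_right (Nat.cast_le.2 hcard)
        (mul_nonneg (Nat.cast_nonneg _) ((τ j).L_nonneg q))
    _ = _ := (mul_assoc _ _ _).symm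

lemma volume_real_locallyHeld_le_intraTerm [Fintype Θ] (h : R.Legal P) (i : ι) (k : ℕ) (r d : ℝ) :
    (volume.restrict (Set.Ico r d)).real {t | R.LocallyHeld i k t} ≤ intraTerm τ i := by
  have hunion : {t | R.LocallyHeld i k t} =
      ⋃ q ∈ (τ i).resources, {t | R.JobHolds i k q t} := by
    ext t
    simp [LocallyHeld, DAGTask.mem_resources]
  exact hunion ▸ (measureReal_biUnion_finset_le _ _).trans
    (Finset.sum_le_sum fun q _ => h.volume_real_jobHolds_le i k q r d)

lemma volume_real_remotelyHeld_le_interTerm [Fintype Θ] [Fintype ι] [DecidableEq ι]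
    (h : R.Legal P) {i : ι} {k : ℕ}
    (hearlier : ∀ j l, R.deadline j l < R.deadline i k → R.MeetsDeadline j l) :
    (volume.restrict (R.window i k)).real {t | R.RemotelyHeld i t} ≤ interTerm τ i := by
  have hunion : {t | R.RemotelyHeld i t} =
      ⋃ j ∈ Finset.univ.erase i, ⋃ q ∈ (τ i).resources, {t | R.TaskHolds j q t} := by
    ext t
    simp [RemotelyHeld, DAGTask.mem_resources]
  rw [hunion]
  refine (measureReal_biUnion_finset_le _ _).trans (Finset.sum_le_sum fun j _ => ?_)
  refine (measureReal_biUnion_finset_le _ _).trans (Finset.sum_le_sum fun q hq => ?_)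
  by_cases hjq : (τ j).Accesses q
  · rw [eta, if_pos ⟨DAGTask.mem_resources.1 hq, hjq⟩]
    have hheld := h.volume_real_taskHolds_le j q (r := R.release i k) (hearlier j)
    rwa [deadline, add_sub_cancel_left] at hheld
  · have hnever : {t | R.TaskHolds j q t} = ∅ :=
      Set.eq_empty_of_forall_notMem fun t ⟨k', a, ha⟩ => hjq (h.accesses_of_holder ha)
    have hN : (τ j).N q = 0 := Nat.eq_zero_of_not_pos hjq
    simp [hnever, hN]

end Locks

section Window

lemma release_add_le (h : R.Legal P) (i : ι) {k k' : ℕ} (hk : k < k') :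
    R.release i k + (τ i).T ≤ R.release i k' := by
  have hgap := sub_mul_le_sub_of_add_le_succ (h.release_sep i) hk.le
  have hone : (1 : ℝ) ≤ k' - k := by
    rw [← Nat.cast_sub hk.le]
    exact Nat.one_le_cast.2 (Nat.sub_pos_of_lt hk)
  linarith [le_mul_of_one_le_left (τ i).T_pos.le hone]

lemma deadline_strictMono (h : R.Legal P) (i : ι) : StrictMono (R.deadline i) := fun k k' hk => by
  have hrelease := h.release_add_le i hk
  have hT := (τ i).T_pos
  unfold deadline
  linarith

-- As `D ≤ T`, the earlier jobs of the task are finished and the later ones are not yet released.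
lemma eq_of_busy (h : R.Legal P) {i : ι} {k : ℕ} (hprev : ∀ l < k, R.MeetsDeadline i l) {t : ℝ}
    (ht : t ∈ R.window i k) {x : JobVertex τ} (hx : x.task = i) (hbusy : R.Busy x t) :
    ∃ a, x = ⟨i, k, a⟩ := by
  obtain ⟨j, l, a⟩ := x
  obtain rfl : j = i := hx
  obtain ⟨⟨hreleased, -⟩, hunfinished⟩ := h.busy_eligible _ _ hbusy
  rcases lt_trichotomy l k with hl | rfl | hl
  · have hdeadline : R.deadline j l ≤ t :=
      (add_le_add_right (τ j).D_le_T _).trans ((h.release_add_le j hl).trans ht.1)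
    exact absurd (h.done_mono hdeadline (hprev l hl a)) hunfinished
  · exact ⟨a, rfl⟩
  · have hdeadline : R.deadline j k ≤ R.release j l :=
      (add_le_add_right (τ j).D_le_T _).trans (h.release_add_le j hl)
    exact absurd (ht.2.trans_le (hdeadline.trans hreleased)) (lt_irrefl t)

lemma executing_of_busy (h : R.Legal P) {i : ι} {k : ℕ} (hprev : ∀ l < k, R.MeetsDeadline i l)
    {t : ℝ} (ht : t ∈ R.window i k) (hremote : ¬ R.RemotelyHeld i t)
    (hlocal : ¬ R.LocallyHeld i k t) {a : (τ i).V} (hbusy : R.Busy ⟨i, k, a⟩ t) :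
    R.Executing ⟨i, k, a⟩ t := by
  refine ⟨hbusy, fun q hspin => ?_⟩
  obtain ⟨y, hy⟩ := Option.ne_none_iff_exists'.1 (h.spin_held _ q t hspin)
  obtain ⟨-, ⟨s, hs, rfl⟩, -⟩ := hspin
  have hacc : (τ i).Accesses s.res := h.accesses_of_mem_sections hs.1
  by_cases hyi : y.task = i
  · obtain ⟨c, rfl⟩ := h.eq_of_busy hprev ht hyi (h.holder_spec _ t y hy).1
    exact hlocal ⟨s.res, hacc, c, hy⟩
  · exact hremote ⟨y.task, hyi, s.res, hacc, y.job, y.vertex, hy⟩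

lemma exists_card_le_forall_executing (h : R.Legal P)
    (hP : Pairwise fun i j => Disjoint (P i) (P j)) {i : ι} {k : ℕ}
    (hprev : ∀ l < k, R.MeetsDeadline i l) {t : ℝ} (ht : t ∈ R.window i k)
    (hremote : ¬ R.RemotelyHeld i t) (hlocal : ¬ R.LocallyHeld i k t) {a : (τ i).V}
    (hready : R.Eligible ⟨i, k, a⟩ t) (hunfinished : ¬ R.Done ⟨i, k, a⟩ t)
    (hwaiting : ¬ R.Busy ⟨i, k, a⟩ t) :
    ∃ s : Finset (τ i).V, (P i).card ≤ s.card ∧ ∀ c ∈ s, R.Executing ⟨i, k, c⟩ t := by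
  classical
  have hoccupied (p : P i) : ∃ c, R.proc p t = some ⟨i, k, c⟩ := by
    obtain ⟨y, hy⟩ := Option.ne_none_iff_exists'.1
      (h.work_conserving _ t hready hunfinished hwaiting p p.2)
    have hyi : y.task = i := by
      by_contra hne
      exact Finset.disjoint_left.1 (hP hne) (h.proc_mem p t y hy) p.2
    obtain ⟨c, rfl⟩ := h.eq_of_busy hprev ht hyi ⟨p, hy⟩
    exact ⟨c, hy⟩
  choose f hf using hoccupied
  have hinj : Function.Injective f := fun p p' hpp =>
    Subtype.ext (h.proc_inj p p' t _ (hf p) (hpp ▸ hf p'))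
  refine ⟨Finset.univ.image f, ?_, fun c hc => ?_⟩
  · rw [Finset.card_image_of_injective _ hinj, Finset.card_univ, Fintype.card_coe]
  · obtain ⟨p, -, rfl⟩ := Finset.mem_image.1 hc
    exact h.executing_of_busy hprev ht hremote hlocal ⟨p, hf p⟩

lemma exists_isCompletePath_forall_mem_window (h : R.Legal P)
    (hP : Pairwise fun i j => Disjoint (P i) (P j)) {i : ι} {k : ℕ}
    (hprev : ∀ l < k, R.MeetsDeadline i l) (hmiss : ¬ R.MeetsDeadline i k) :
    ∃ π, (τ i).IsCompletePath π ∧ ∀ t ∈ R.window i k, R.RemotelyHeld i t ∨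
      ((R.LocallyHeld i k t ∨ ∃ a ∈ π, R.Executing ⟨i, k, a⟩ t) ∧
        ∃ a, R.Executing ⟨i, k, a⟩ t) ∨
      ∃ s : Finset (τ i).V, (P i).card ≤ s.card ∧ ∀ a ∈ s, R.Executing ⟨i, k, a⟩ t := by
  obtain ⟨b, hb⟩ := not_forall.1 hmiss
  obtain ⟨π, hπ, hcritical⟩ := DAGTask.exists_isCompletePath_forall_mem_exists_ready
    (U := fun a => {t | ¬ R.Done ⟨i, k, a⟩ t}) (fun a t t' htt => mt (h.done_mono htt)) b
  refine ⟨π, hπ, fun t ht => or_iff_not_imp_left.2 fun hremote => ?_⟩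
  by_cases hlocal : R.LocallyHeld i k t
  · have ⟨q, _, a, ha⟩ := hlocal
    exact .inl ⟨.inl hlocal, a, h.executing_of_holder ha⟩
  obtain ⟨a, haπ, hunfinished, hdone⟩ := hcritical t (mt (h.done_mono ht.2.le) hb)
  by_cases hbusy : R.Busy ⟨i, k, a⟩ t
  · have hexec := h.executing_of_busy hprev ht hremote hlocal hbusy
    exact .inl ⟨.inr ⟨a, haπ, hexec⟩, a, hexec⟩
  · exact .inr <| h.exists_card_le_forall_executing hP hprev ht hremote hlocal
      ⟨ht.1, fun c hc => not_not.1 (hdone c hc)⟩ hunfinished hbusy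

lemma sum_volume_real_executing_lt_totalWork (h : R.Legal P) {i : ι} {k : ℕ}
    (hmiss : ¬ R.MeetsDeadline i k) :
    ∑ a, (volume.restrict (R.window i k)).real {t | R.Executing ⟨i, k, a⟩ t} <
      (τ i).totalWork := by
  obtain ⟨b, hb⟩ := not_forall.1 hmiss
  simp only [h.volume_real_executing_window]
  exact Finset.sum_lt_sum (fun a _ => h.progress_le_wcet ⟨i, k, a⟩ _)
    ⟨b, Finset.mem_univ b, (not_le.1 hb).trans_le (h.exec_le_wcet ⟨i, k, b⟩)⟩

end Window

section Deadlines

lemma tendsto_deadline [Finite ι] (h : R.Legal P) :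
    Filter.Tendsto (fun x : ι × ℕ => R.deadline x.1 x.2) Filter.cofinite Filter.atTop := by
  refine Filter.tendsto_atTop.2 fun d => Filter.eventually_cofinite.2 ?_
  have hfin (i : ι) : {k | ¬ d ≤ R.deadline i k}.Finite := by
    rw [← Filter.eventually_cofinite, Nat.cofinite_eq_atTop]
    exact (Filter.tendsto_atTop_add_const_right _ _ (h.tendsto_release i)).eventually_ge_atTop d
  exact (Set.finite_iUnion fun i => (hfin i).image (Prod.mk i)).subset fun ⟨i, k⟩ hx =>
    Set.mem_iUnion.2 ⟨i, k, hx, rfl⟩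

lemma deadline_induction [Finite ι] (h : R.Legal P) {p : ι → ℕ → Prop}
    (step : ∀ i k, (∀ j l, R.deadline j l < R.deadline i k → p j l) → p i k) (i : ι) (k : ℕ) :
    p i k := by
  by_contra hik
  obtain ⟨⟨j, l⟩, hjl, hmin⟩ :=
    h.tendsto_deadline.exists_within_forall_le (s := {x : ι × ℕ | ¬ p x.1 x.2}) ⟨(i, k), hik⟩
  exact hjl <| step j l fun j' l' hlt => by
    by_contra hj'l'
    exact hlt.not_ge (hmin (j', l') hj'l')

lemma schedulable_iff (h : R.Legal P) (i : ι) :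
    R.Schedulable i ↔ ∀ k, R.MeetsDeadline i k := by
  rw [Schedulable, wcrt, iSup_le_iff]
  refine forall_congr' fun k => ?_
  have hfinish : R.responseTime i k ≤ ((τ i).D : EReal) ↔
      R.finish i k ≤ (R.deadline i k : EReal) := by
    rw [responseTime, EReal.sub_le_iff_le_add (.inl (EReal.coe_ne_bot _))
      (.inl (EReal.coe_ne_top _)), deadline, EReal.coe_add, add_comm]
  rw [hfinish]
  constructor
  · intro hle a
    have hafter (t : ℝ) (ht : R.deadline i k < t) : R.Done ⟨i, k, a⟩ t := by
      obtain ⟨_, ⟨s, hs, rfl⟩, hst⟩ := sInf_lt_iff.1 (hle.trans_lt (EReal.coe_lt_coe_iff.2 ht))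
      exact h.done_mono (EReal.coe_lt_coe_iff.1 hst).le (hs.2 a)
    exact ge_of_tendsto (h.continuous_progress ⟨i, k, a⟩).continuousWithinAt
      (Filter.eventually_of_mem (self_mem_nhdsWithin (s := Set.Ioi _)) hafter)
  · intro hdone
    exact sInf_le ⟨_, ⟨R.release_le_deadline i k, hdone⟩, rfl⟩

variable [Fintype Θ] [Fintype ι] [DecidableEq ι]

lemma card_mul_D_lt (h : R.Legal P) (hP : Pairwise fun i j => Disjoint (P i) (P j)) {i : ι}
    (hne : (P i).Nonempty) {k : ℕ}
    (hearlier : ∀ j l, R.deadline j l < R.deadline i k → R.MeetsDeadline j l)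
    (hmiss : ¬ R.MeetsDeadline i k) :
    (P i).card * (τ i).D < (P i).card * interTerm τ i +
      ((P i).card - 1) * (intraTerm τ i + (τ i).longest) + (τ i).totalWork := by
  obtain ⟨π, hπ, hcover⟩ := h.exists_isCompletePath_forall_mem_window hP
    (fun l hl => hearlier i l (h.deadline_strictMono i hl)) hmiss
  have hgraham := mul_measureReal_univ_le_of_card_le (volume.restrict (R.window i k))
    {t | R.RemotelyHeld i t} ({t | R.LocallyHeld i k t} ∪ {t | ∃ a ∈ π, R.Executing ⟨i, k, a⟩ t})
    (fun a => {t | R.Executing ⟨i, k, a⟩ t}) hne.card_pos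
    ((ae_restrict_mem measurableSet_Ico).mono hcover)
  rw [measureReal_restrict_apply_univ, Real.volume_real_Ico_of_le (R.release_le_deadline i k),
    deadline, add_sub_cancel_left] at hgraham
  have hremote := h.volume_real_remotelyHeld_le_interTerm hearlier
  have hcritical := (measureReal_union_le {t | R.LocallyHeld i k t}
    {t | ∃ a ∈ π, R.Executing ⟨i, k, a⟩ t}).trans <| add_le_add
      (h.volume_real_locallyHeld_le_intraTerm i k (R.release i k) (R.deadline i k))
      (h.volume_real_exists_mem_executing_le_longest i k hπ)
  have hwork := h.sum_volume_real_executing_lt_totalWork hmiss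
  have hM : (0 : ℝ) ≤ (P i).card - 1 := sub_nonneg.2 (Nat.one_le_cast.2 hne.card_pos)
  exact hgraham.trans_lt (add_lt_add_of_le_of_lt (by gcongr) hwork)

lemma meetsDeadline_of_procCount_le (h : R.Legal P)
    (hP : Pairwise fun i j => Disjoint (P i) (P j)) {i : ι} (hS : 0 < slack τ i)
    (hne : (P i).Nonempty) (hcard : procCount τ i ≤ (P i).card) {k : ℕ}
    (hearlier : ∀ j l, R.deadline j l < R.deadline i k → R.MeetsDeadline j l) :
    R.MeetsDeadline i k := by
  by_contra hmiss
  have hlt := h.card_mul_D_lt hP hne hearlier hmiss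
  have hprocs := (procCount_le_iff hS).1 hcard
  rw [slack] at hprocs
  linarith

lemma schedulable_of_procCount_le (h : R.Legal P)
    (hP : Pairwise fun i j => Disjoint (P i) (P j))
    (hrule : ∀ j, R.Schedulable j ∨
      0 < slack τ j ∧ (P j).Nonempty ∧ procCount τ j ≤ (P j).card) (i : ι) :
    R.Schedulable i :=
  (h.schedulable_iff i).2 fun k => h.deadline_induction (fun i k hearlier =>
    (hrule i).elim (fun hi => (h.schedulable_iff i).1 hi k) fun ⟨hS, hne, hcard⟩ =>
      h.meetsDeadline_of_procCount_le hP hS hne hcard hearlier) i k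

end Deadlines

end Legal

end Run

section Algorithm

variable {ι : Type w} {Θ : Type v} [Fintype ι] [DecidableEq ι] [Fintype Θ]
  (τ : ι → DAGTask.{u, v} Θ) {ts : List ι}

lemma partitionAlg_eq_some_iff (hts : ts.Nodup) (avail : ℕ) (A₀ A : ι → ℕ) :
    partitionAlg τ ts avail A₀ = some A ↔
      (∀ i ∈ ts, 0 < slack τ i) ∧ (ts.map (procCount τ)).sum ≤ avail ∧
        A = fun i => if i ∈ ts then procCount τ i else A₀ i := by
  induction ts generalizing avail A₀ with
  | nil => simp [partitionAlg, eq_comm]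
  | cons i ts ih =>
    obtain ⟨hi, hts⟩ := List.nodup_cons.1 hts
    have hassigned : (fun j => if j ∈ ts then procCount τ j else
        Function.update A₀ i (procCount τ i) j) =
        fun j => if j ∈ i :: ts then procCount τ j else A₀ j := by
      funext j
      rcases eq_or_ne j i with rfl | hj
      · simp [hi]
      · simp [hj]
    rw [partitionAlg, List.forall_mem_cons, List.map_cons, List.sum_cons, ← hassigned]
    split_ifs with hS hav
    · have hshort : ¬ procCount τ i + (ts.map (procCount τ)).sum ≤ avail := by omega
      simp [hshort]
    · rw [ih hts, Nat.le_sub_iff_add_le' (not_lt.1 hav)]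
      simp [hS]
    · simp [hS]

lemma partitionAlg_eq_some_iff_of_forall_mem (hts : ts.Nodup) (hall : ∀ i, i ∈ ts) (m : ℕ)
    (A₀ A : ι → ℕ) :
    partitionAlg τ ts m A₀ = some A ↔
      (∀ i, 0 < slack τ i) ∧ ∑ i, procCount τ i ≤ m ∧ A = procCount τ := by
  have hsum : (ts.map (procCount τ)).sum = ∑ i, procCount τ i := by
    rw [← List.sum_toFinset _ hts, Finset.eq_univ_of_forall fun i => List.mem_toFinset.2 (hall i)]
  rw [partitionAlg_eq_some_iff τ hts, hsum]
  simp [hall]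

end Algorithm

lemma exists_pairwise_disjoint_card_eq {ι κ : Type*} [Fintype ι] [Fintype κ] {A : ι → ℕ}
    (hA : ∑ i, A i ≤ Fintype.card κ) :
    ∃ P : ι → Finset κ, Pairwise (fun i j => Disjoint (P i) (P j)) ∧ ∀ i, (P i).card = A i := by
  obtain ⟨e⟩ : Nonempty ((Σ i, Fin (A i)) ↪ κ) :=
    Function.Embedding.nonempty_of_card_le (by simpa using hA)
  refine ⟨fun i => Finset.univ.map ((Function.Embedding.sigmaMk i).trans e), ?_, by simp⟩
  intro i j hij
  refine Finset.disjoint_left.2 fun p hi hj => hij ?_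
  simp only [Finset.mem_map, Finset.mem_univ, true_and, Function.Embedding.trans_apply] at hi hj
  obtain ⟨x, rfl⟩ := hi
  obtain ⟨y, hy⟩ := hj
  exact congrArg Sigma.fst (e.injective hy).symm

theorem mainTheorem5_general {ι : Type*} {Θ : Type*} [Fintype ι] [DecidableEq ι] [Fintype Θ]
    [DecidableEq Θ] (τ : ι → DAGTask Θ) (m : ℕ) :
    (∀ P : ι → Finset (Fin m), Pairwise (fun i j => Disjoint (P i) (P j)) →
      ∀ R : Run τ m, R.Legal P →
        ∀ i, 0 < slack τ i → (P i).Nonempty → procCount τ i ≤ (P i).card →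
          (∀ j, j ≠ i → R.Schedulable j ∨
            (0 < slack τ j ∧ (P j).Nonempty ∧ procCount τ j ≤ (P j).card)) →
          R.Schedulable i) ∧
    (∀ ts : List ι, ts.Nodup → (∀ i, i ∈ ts) → ∀ A : ι → ℕ,
      partitionAlg τ ts m (fun _ => 0) = some A ↔
        (∀ i, 0 < slack τ i) ∧ ∑ i, procCount τ i ≤ m ∧ A = procCount τ) ∧
    (∀ ts : List ι, ts.Nodup → (∀ i, i ∈ ts) → ∀ A : ι → ℕ,
      partitionAlg τ ts m (fun _ => 0) = some A →
        (∃ P : ι → Finset (Fin m), Pairwise (fun i j => Disjoint (P i) (P j)) ∧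
          ∀ i, (P i).card = A i) ∧
        ∀ P : ι → Finset (Fin m), Pairwise (fun i j => Disjoint (P i) (P j)) →
          (∀ i, (P i).Nonempty ∧ A i ≤ (P i).card) →
          ∀ R : Run τ m, R.Legal P → ∀ i, R.Schedulable i) := by
  refine ⟨fun P hP R hR i hS hne hcard hrule => ?_,
    fun ts hts hall A => partitionAlg_eq_some_iff_of_forall_mem τ hts hall m _ A,
    fun ts hts hall A hA => ?_⟩
  · refine hR.schedulable_of_procCount_le hP (fun j => ?_) i
    rcases eq_or_ne j i with rfl | hj
    · exact .inr ⟨hS, hne, hcard⟩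
    · exact hrule j hj
  · obtain ⟨hS, hm, rfl⟩ := (partitionAlg_eq_some_iff_of_forall_mem τ hts hall m _ A).1 hA
    exact ⟨exists_pairwise_disjoint_card_eq (hm.trans_eq (Fintype.card_fin m).symm),
      fun P hP hcard R hR => hR.schedulable_of_procCount_le hP fun j => .inr ⟨hS j, hcard j⟩⟩

theorem mainTheorem5 {ι : Type*} {Θ : Type*} [Fintype ι] [DecidableEq ι] [Fintype Θ]
    [DecidableEq Θ] (τ : ι → DAGTask Θ) (hdens : ∀ i, 1 < (τ i).density) (m : ℕ) :
    -- a task with positive slack is schedulable on `m_i` processors, in every run in which each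
    -- other task is schedulable or is itself given processors by the same rule
    (∀ P : ι → Finset (Fin m), Pairwise (fun i j => Disjoint (P i) (P j)) →
      ∀ R : Run τ m, R.Legal P →
        ∀ i, 0 < slack τ i → (P i).card = procCount τ i →
          (∀ j, j ≠ i → R.Schedulable j ∨ (0 < slack τ j ∧ (P j).card = procCount τ j)) →
          R.Schedulable i) ∧
    -- the algorithm succeeds exactly if each task has positive slack and can get `m_i` processors
    (∀ ts : List ι, ts.Nodup → (∀ i, i ∈ ts) → ∀ A : ι → ℕ,
      partitionAlg τ ts m (fun _ => 0) = some A ↔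
        (∀ i, 0 < slack τ i) ∧ ∑ i, procCount τ i ≤ m ∧ A = procCount τ) ∧
    -- and then its answer can be realized and makes the whole system schedulable
    (∀ ts : List ι, ts.Nodup → (∀ i, i ∈ ts) → ∀ A : ι → ℕ,
      partitionAlg τ ts m (fun _ => 0) = some A →
        (∃ P : ι → Finset (Fin m), Pairwise (fun i j => Disjoint (P i) (P j)) ∧
          ∀ i, (P i).card = A i) ∧
        ∀ P : ι → Finset (Fin m), Pairwise (fun i j => Disjoint (P i) (P j)) →
          (∀ i, (P i).card = A i) →
          ∀ R : Run τ m, R.Legal P → ∀ i, R.Schedulable i) := by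
  obtain ⟨hpart, halg, hrealize⟩ := mainTheorem5_general τ m
  have hrule {P : ι → Finset (Fin m)} {i : ι} (hS : 0 < slack τ i)
      (hcard : (P i).card = procCount τ i) : (P i).Nonempty ∧ procCount τ i ≤ (P i).card :=
    ⟨Finset.card_pos.1 (hcard ▸ procCount_pos (hdens i) hS), hcard.ge⟩
  refine ⟨fun P hP R hR i hS hcard hothers => ?_, halg, fun ts hts hall A hA => ?_⟩
  · exact hpart P hP R hR i hS (hrule hS hcard).1 (hrule hS hcard).2 fun j hj =>
      (hothers j hj).imp_right fun ⟨hSj, hcardj⟩ => ⟨hSj, hrule hSj hcardj⟩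
  · obtain ⟨hexists, hsched⟩ := hrealize ts hts hall A hA
    obtain ⟨hS, -, rfl⟩ := (halg ts hts hall A).1 hA
    exact ⟨hexists, fun P hP hcard => hsched P hP fun i => hrule (hS i) (hcard i)⟩
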